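/- Let $m_1,m_2,m_3\ge 1$, $J_a\subseteq[m_a]$ for $a=1,2,3$, $l=|J_1|$, and let $\mathcal T=\mathcal X+\mathcal Z\in\mathbb R^{m_1\times m_2\times m_3}$, where $\mathcal X=\gamma\,\mathbf w\otimes\mathbf u\otimes\mathbf v$ with $\gamma>0$ and unit vectors $\mathbf w\in\mathbb R^{m_1}$, $\mathbf u\in\mathbb R^{m_2}$, $\mathbf v\in\mathbb R^{m_3}$ is a deterministic tensor that vanishes outside $J_1\times J_2\times J_3$, and $\mathcal Z$ is a random tensor whose entries $\mathcal Z_{ijk}$ with $i\notin J_1$ are independent standard normal variables (the other entries are arbitrary random variables). For $i\in[m_1]$ let $T_i=\mathcal T(i,:,:)\in\mathbb R^{m_2\times m_3}$ and $C_i=T_i^tT_i$, let $\underline\lambda_i$ be the largest eigenvalue of $C_i$ and $\tilde{\mathbf v}_i$ a unit eigenvector for it. Put $\lambda=\max_{i}\underline\lambda_i$, $\tilde\lambda_i=\underline\lambda_i/\lambda$ and $$d_i=\sum_{j=1}^{m_1}\bigl|\langle\tilde\lambda_i\tilde{\mathbf v}_i,\tilde\lambda_j\tilde{\mathbf v}_j\rangle\bigr|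 .$$ Let $\mu=(\sqrt{m_2-1}+\sqrt{m_3})^2$ if $m_2\ge m_3$, and $\mu=(\sqrt{m_3-1}+\sqrt{m_2})^2$ if $m_2<m_3$. For all constants $c,\kappa>0$ there is a constant $c_1>0$, depending only on $c$ and $\kappa$, such that the following holds for all such data with $\sqrt{\log(m_1-l)}\le\kappa\,\mu$ and for every $i\in[m_1]\setminus J_1$: with probability at least $1-e\,(m_1-l)^{-c_1}$, $$\text{if}\quad \lambda\ge c\,\mu\,m_1,\qquad\text{then}\quad d_i\le\frac{l}{m_1}+\sqrt{\log(m_1-l)}$$ for every choice of the top eigenvectors $\tilde{\mathbf v}_1,\dots,\tilde{\mathbf v}_{m_1}$. -/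

import Mathlib

open MeasureTheory ProbabilityTheory

namespace MultiSlice

/-- Real tensors of order three and format `m₁ × m₂ × m₃`. -/
abbrev Tensor (m₁ m₂ m₃ : ℕ) : Type := Fin m₁ → Fin m₂ → Fin m₃ → ℝ

/-- The rank-one tensor `γ • w ⊗ u ⊗ v`. -/
def rankOne {m₁ m₂ m₃ : ℕ} (γ : ℝ) (w : EuclideanSpace ℝ (Fin m₁))
    (u : EuclideanSpace ℝ (Fin m₂)) (v : EuclideanSpace ℝ (Fin m₃)) : Tensor m₁ m₂ m₃ :=
  fun i j k => γ * w i * u j * v k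

/-- `γ • w ⊗ u ⊗ v` is a signal tensor with tricluster `(J₁, J₂, J₃)`: the strength is positive,
the vectors are normed, and the tensor vanishes outside `J₁ × J₂ × J₃`. -/
structure IsSignal {m₁ m₂ m₃ : ℕ} (J₁ : Finset (Fin m₁)) (J₂ : Finset (Fin m₂))
    (J₃ : Finset (Fin m₃)) (γ : ℝ) (w : EuclideanSpace ℝ (Fin m₁))
    (u : EuclideanSpace ℝ (Fin m₂)) (v : EuclideanSpace ℝ (Fin m₃)) : Prop where
  strength_pos : 0 < γ
  norm_w : ‖w‖ = 1
  norm_u : ‖u‖ = 1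
  norm_v : ‖v‖ = 1
  support : ∀ i j k, ¬ (i ∈ J₁ ∧ j ∈ J₂ ∧ k ∈ J₃) → rankOne γ w u v i j k = 0

/-- `Z` is a random noise tensor whose entries in the slices outside the cluster `J₁` are
independent standard normal variables. The entries in the slices of `J₁` are arbitrary random
variables (in particular they may be standard normal and independent of all the others). -/
structure IsNoise {Ω : Type*} [MeasurableSpace Ω] (P : Measure Ω) {m₁ m₂ m₃ : ℕ}
    (J₁ : Finset (Fin m₁)) (Z : Ω → Tensor m₁ m₂ m₃) : Prop where
  measurable : ∀ i j k, Measurable (fun ω => Z ω i j k)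
  law : ∀ i, i ∉ J₁ → ∀ j k, P.map (fun ω => Z ω i j k) = gaussianReal 0 1
  indep : iIndepFun
    (fun (p : {i : Fin m₁ // i ∉ J₁} × Fin m₂ × Fin m₃) ω => Z ω p.1.1 p.2.1 p.2.2) P

/-- The `i`-th horizontal slice `T_i = T(i, :, :)`. -/
def slice {m₁ m₂ m₃ : ℕ} (T : Tensor m₁ m₂ m₃) (i : Fin m₁) : Matrix (Fin m₂) (Fin m₃) ℝ :=
  Matrix.of (T i)

/-- The covariance matrix `C_i = T_iᵗ T_i` of the `i`-th slice. -/
def cov {m₁ m₂ m₃ : ℕ} (T : Tensor m₁ m₂ m₃) (i : Fin m₁) : Matrix (Fin m₃) (Fin m₃) ℝ :=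
  (slice T i).transpose * slice T i

theorem cov_isHermitian {m₁ m₂ m₃ : ℕ} (T : Tensor m₁ m₂ m₃) (i : Fin m₁) :
    (cov T i).IsHermitian := by
  have h := Matrix.isHermitian_conjTranspose_mul_self (slice T i)
  rwa [Matrix.conjTranspose_eq_transpose_of_trivial] at h

/-- The top eigenvalue of `C_i`. -/
noncomputable def topEigenvalue {m₁ m₂ m₃ : ℕ} (T : Tensor m₁ m₂ m₃) (i : Fin m₁) : ℝ :=
  ⨆ k : Fin m₃, (cov_isHermitian T i).eigenvalues k

/-- `λ`, the maximum over all slices of the top eigenvalues. -/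
noncomputable def maxTopEigenvalue {m₁ m₂ m₃ : ℕ} (T : Tensor m₁ m₂ m₃) : ℝ :=
  ⨆ i : Fin m₁, topEigenvalue T i

/-- `x i` is, for every `i`, a unit eigenvector of `C_i` for its top eigenvalue. -/
def IsTopEigenvectorFamily {m₁ m₂ m₃ : ℕ} (T : Tensor m₁ m₂ m₃)
    (x : Fin m₁ → EuclideanSpace ℝ (Fin m₃)) : Prop :=
  ∀ i, ‖x i‖ = 1 ∧ Matrix.toEuclideanLin (cov T i) (x i) = topEigenvalue T i • x i

/-- The normalized top eigenvalue of the `i`-th slice. -/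
noncomputable def normTopEigenvalue {m₁ m₂ m₃ : ℕ} (T : Tensor m₁ m₂ m₃) (i : Fin m₁) : ℝ :=
  topEigenvalue T i / maxTopEigenvalue T

/-- The similarity `c_ij` of the slices `i` and `j`, from the top eigenvectors `x`. -/
noncomputable def similarity {m₁ m₂ m₃ : ℕ} (T : Tensor m₁ m₂ m₃)
    (x : Fin m₁ → EuclideanSpace ℝ (Fin m₃)) (i j : Fin m₁) : ℝ :=
  |inner ℝ (normTopEigenvalue T i • x i) (normTopEigenvalue T j • x j)|

/-- The marginal sum `d_i = ∑ⱼ c_ij`. -/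
noncomputable def marginal {m₁ m₂ m₃ : ℕ} (T : Tensor m₁ m₂ m₃)
    (x : Fin m₁ → EuclideanSpace ℝ (Fin m₃)) (i : Fin m₁) : ℝ :=
  ∑ j, similarity T x i j

/-- The centering constant `μ` of the top eigenvalue of a white Wishart matrix:
`(√(m₂ - 1) + √m₃)²` if `m₃ ≤ m₂`, with the roles of `m₂` and `m₃` reversed if `m₂ < m₃`. -/
noncomputable def centering (m₂ m₃ : ℕ) : ℝ :=
  if m₃ ≤ m₂ then (√((m₂ : ℝ) - 1) + √(m₃ : ℝ)) ^ 2 else (√((m₃ : ℝ) - 1) + √(m₂ : ℝ)) ^ 2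

end MultiSlice

namespace MultiSlice

/-! ### Operator norm and exponential integrals over a ball. -/

open Metric Module

/-! Cauchy–Schwarz bounds each term of `d_i` by `λ̃_i`, so `d_i ≤ m₁ λ_i / λ` (`marginal_le`).
Outside `J₁` the slice is pure noise, so `λ_i ≤ ‖Z_i‖²`; if `λ ≥ c μ m₁`, it suffices that `‖Z_i‖² ≤
c μ s` with `s = √(log (m₁ - l))`. The term `l / m₁` is only slack.

The tail of `‖Z_i‖` (`exists_event_norm_lt`) comes from a volume argument in place of a net: the
form `⟨y, A x⟩` is at least `‖A‖ / 16` on a whole ball of radius `1/4`, so `exp (θ ‖A‖ / 16)` is at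
most `4 ^ (m + n)` times the average of `exp (θ ⟨y, A x⟩)` over the unit ball. Tonelli and the
Gaussian moment generating function bound the mean of that average by `exp (θ² / 2)`. -/

theorem exists_forall_mem_ball_norm_le_inner {E F : Type*} [NormedAddCommGroup E]
    [InnerProductSpace ℝ E] [NormedAddCommGroup F] [InnerProductSpace ℝ F] (A : E →L[ℝ] F) :
    ∃ p : F × E, ‖p‖ ≤ 3 / 4 ∧ ∀ q ∈ ball p (1 / 4), ‖A‖ / 16 ≤ inner ℝ q.1 (A q.2) := by
  obtain ⟨x, hx, hAx⟩ : ∃ x : E, ‖x‖ ≤ 1 ∧ 8 / 9 * ‖A‖ ≤ ‖A x‖ := by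
    rcases (norm_nonneg A).eq_or_lt with h | h
    · exact ⟨0, by simp, by simp [← h]⟩
    · obtain ⟨x, hx, hx'⟩ := A.exists_lt_apply_of_lt_opNorm (r := 8 / 9 * ‖A‖) (by linarith)
      exact ⟨x, hx.le, hx'.le⟩
  obtain ⟨y, hy, hyx⟩ : ∃ y : F, ‖y‖ ≤ 1 ∧ inner ℝ y (A x) = ‖A x‖ := by
    refine ⟨‖A x‖⁻¹ • A x, ?_, ?_⟩
    · rw [norm_smul, norm_inv, norm_norm]
      exact inv_mul_le_one
    · rw [real_inner_smul_left, real_inner_self_eq_norm_sq]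
      rcases eq_or_ne ‖A x‖ 0 with h | h
      · simp [h]
      · field_simp
  -- Shrinking by `3/4` keeps the `1/4`-ball inside the unit ball. The form is at least `(9/16)(8/9)
  -- = 1/2` at the centre, and perturbations cost at most `2 · 3/16 + 1/16`, all in units of `‖A‖`;
  -- this leaves `1/16`.
  refine ⟨((3 / 4 : ℝ) • y, (3 / 4 : ℝ) • x), ?_, ?_⟩
  · rw [Prod.norm_def, max_le_iff, norm_smul, norm_smul]
    norm_num
    exact ⟨hy, hx⟩
  · rintro ⟨y', x'⟩ hq
    rw [mem_ball, Prod.dist_eq, max_lt_iff, dist_eq_norm, dist_eq_norm] at hq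
    obtain ⟨a, rfl⟩ : ∃ a, y' = (3 / 4 : ℝ) • y + a := ⟨y' - (3 / 4 : ℝ) • y, by abel⟩
    obtain ⟨b, rfl⟩ : ∃ b, x' = (3 / 4 : ℝ) • x + b := ⟨x' - (3 / 4 : ℝ) • x, by abel⟩
    simp only [add_sub_cancel_left] at hq
    have key (z : F) (w : E) (r s : ℝ) (hz : ‖z‖ ≤ r) (hw : ‖w‖ ≤ s) :
        -(r * s * ‖A‖) ≤ inner ℝ z (A w) := by
      have hr := (norm_nonneg z).trans hz
      have h : ‖z‖ * ‖A w‖ ≤ r * (‖A‖ * s) :=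
        mul_le_mul hz (A.le_opNorm_of_le hw) (norm_nonneg _) hr
      have := (abs_le.1 (abs_real_inner_le_norm z (A w))).1
      linarith
    have h1 := key y b 1 (1 / 4) hy hq.2.le
    have h2 := key a x (1 / 4) 1 hq.1.le hx
    have h3 := key a b (1 / 4) (1 / 4) hq.1.le hq.2.le
    simp only [map_add, map_smul, inner_add_left, inner_add_right, real_inner_smul_left,
      real_inner_smul_right, hyx]
    linarith

/-- The operator norm of `A` is controlled by an exponential moment of its bilinear form. -/
theorem exp_norm_mul_volume_le {E F : Type*} [NormedAddCommGroup E] [InnerProductSpace ℝ E]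
    [FiniteDimensional ℝ E] [MeasurableSpace E] [BorelSpace E] [NormedAddCommGroup F]
    [InnerProductSpace ℝ F] [FiniteDimensional ℝ F] [MeasurableSpace F] [BorelSpace F]
    (A : E →L[ℝ] F) {θ : ℝ} (hθ : 0 ≤ θ) :
    ENNReal.ofReal (Real.exp (θ * ‖A‖ / 16) * (1 / 4) ^ (finrank ℝ F + finrank ℝ E)) *
        volume (ball (0 : F × E) 1) ≤
      ∫⁻ q in ball (0 : F × E) 1, ENNReal.ofReal (Real.exp (θ * inner ℝ q.1 (A q.2))) := by
  obtain ⟨p, hp, hq⟩ := exists_forall_mem_ball_norm_le_inner A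
  have hsub : ball p (1 / 4) ⊆ ball (0 : F × E) 1 :=
    ball_subset_ball' (by rw [dist_zero_right]; linarith)
  have : (volume : Measure (F × E)).IsAddHaarMeasure := Measure.prod.instIsAddHaarMeasure _ _
  have hvol : volume (ball p (1 / 4)) = ENNReal.ofReal ((1 / 4) ^ (finrank ℝ F + finrank ℝ E)) *
      volume (ball (0 : F × E) 1) := by
    rw [Measure.addHaar_ball_of_pos _ _ (by norm_num), finrank_prod]
  calc _ = ∫⁻ q in ball p (1 / 4), ENNReal.ofReal (Real.exp (θ * ‖A‖ / 16)) := by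
        rw [setLIntegral_const, hvol, ENNReal.ofReal_mul (Real.exp_nonneg _), mul_assoc]
    _ ≤ ∫⁻ q in ball p (1 / 4), ENNReal.ofReal (Real.exp (θ * inner ℝ q.1 (A q.2))) := by
        refine setLIntegral_mono' measurableSet_ball fun q hqp => ?_
        gcongr
        rw [mul_div_assoc]
        exact mul_le_mul_of_nonneg_left (hq q hqp) hθ
    _ ≤ _ := lintegral_mono_set hsub

/-! ### Gaussian matrices. -/

theorem inner_toEuclideanLin {m n : ℕ} (B : Matrix (Fin m) (Fin n) ℝ)
    (y : EuclideanSpace ℝ (Fin m)) (x : EuclideanSpace ℝ (Fin n)) :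
    inner ℝ y (Matrix.toEuclideanLin B x) = ∑ p : Fin m × Fin n, y p.1 * x p.2 * B p.1 p.2 := by
  simp only [PiLp.inner_apply, Fintype.sum_prod_type, Matrix.toLpLin_apply, Matrix.mulVec,
    dotProduct, RCLike.inner_apply, conj_trivial, Finset.sum_mul]
  exact Finset.sum_congr rfl fun j _ => Finset.sum_congr rfl fun k _ => by ring

/-- A matrix with independent standard normal entries. -/
structure IsStdGaussianMatrix {Ω : Type*} [MeasurableSpace Ω] (P : Measure Ω) {m n : ℕ}
    (B : Ω → Matrix (Fin m) (Fin n) ℝ) : Prop where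
  measurable : ∀ j k, Measurable (fun ω => B ω j k)
  law : ∀ j k, P.map (fun ω => B ω j k) = gaussianReal 0 1
  indep : iIndepFun (fun (p : Fin m × Fin n) ω => B ω p.1 p.2) P

namespace IsStdGaussianMatrix

variable {Ω : Type*} [MeasurableSpace Ω] {P : Measure Ω} {m n : ℕ}
  {B : Ω → Matrix (Fin m) (Fin n) ℝ}

theorem lintegral_exp_inner (hB : IsStdGaussianMatrix P B) (y : EuclideanSpace ℝ (Fin m))
    (x : EuclideanSpace ℝ (Fin n)) (θ : ℝ) :
    ∫⁻ ω, ENNReal.ofReal (Real.exp (θ * inner ℝ y (Matrix.toEuclideanLin (B ω) x))) ∂P =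
      ENNReal.ofReal (Real.exp (θ ^ 2 * (‖y‖ ^ 2 * ‖x‖ ^ 2) / 2)) := by
  have hmgf : ∫ ω, Real.exp (θ * inner ℝ y (Matrix.toEuclideanLin (B ω) x)) ∂P =
      Real.exp (θ ^ 2 * (‖y‖ ^ 2 * ‖x‖ ^ 2) / 2) := by
    have h := (hB.indep.comp (fun p z => y p.1 * x p.2 * z)
      fun p => measurable_const_mul _).mgf_sum (t := θ)
      (fun p => (measurable_const_mul _).comp (hB.measurable p.1 p.2)) Finset.univ
    have h1 (p : Fin m × Fin n) :
        mgf ((fun z => y p.1 * x p.2 * z) ∘ fun ω => B ω p.1 p.2) P θ =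
          Real.exp ((y p.1) ^ 2 * (x p.2) ^ 2 * θ ^ 2 / 2) := by
      rw [show ((fun z => y p.1 * x p.2 * z) ∘ fun ω => B ω p.1 p.2) =
        fun ω => y p.1 * x p.2 * B ω p.1 p.2 from rfl, mgf_const_mul,
        mgf_gaussianReal (hB.law p.1 p.2)]
      congr 1
      push_cast
      ring
    simp only [h1, ← Real.exp_sum] at h
    calc _ = mgf (∑ p : Fin m × Fin n,
          ((fun z => y p.1 * x p.2 * z) ∘ fun ω => B ω p.1 p.2)) P θ := by
          simp [mgf, inner_toEuclideanLin]
      _ = _ := by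
          rw [h]
          congr 1
          rw [EuclideanSpace.real_norm_sq_eq, EuclideanSpace.real_norm_sq_eq,
            Fintype.sum_mul_sum, Fintype.sum_prod_type, Finset.mul_sum, Finset.sum_div]
          refine Finset.sum_congr rfl fun j _ => ?_
          rw [Finset.mul_sum, Finset.sum_div]
          exact Finset.sum_congr rfl fun k _ => by ring
  have hint : Integrable
      (fun ω => Real.exp (θ * inner ℝ y (Matrix.toEuclideanLin (B ω) x))) P := by
    -- A non-integrable function has integral `0` by convention, whereas `hmgf` gives a positive
    -- value.
    by_contra hn
    rw [integral_undef hn] at hmgf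
    exact (Real.exp_pos _).ne hmgf
  rw [← ofReal_integral_eq_lintegral_ofReal hint (ae_of_all _ fun _ => Real.exp_nonneg _), hmgf]

theorem measurable_exp_inner (hB : IsStdGaussianMatrix P B) (θ : ℝ) :
    Measurable fun z : Ω × (EuclideanSpace ℝ (Fin m) × EuclideanSpace ℝ (Fin n)) =>
      ENNReal.ofReal (Real.exp (θ * inner ℝ z.2.1 (Matrix.toEuclideanLin (B z.1) z.2.2))) := by
  simp only [inner_toEuclideanLin]
  refine (Real.measurable_exp.comp (measurable_const.mul
    (Finset.measurable_sum _ fun p _ => ?_))).ennreal_ofReal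
  have h : Measurable fun z : Ω × (EuclideanSpace ℝ (Fin m) × EuclideanSpace ℝ (Fin n)) =>
      B z.1 p.1 p.2 := (hB.measurable p.1 p.2).comp measurable_fst
  exact Measurable.mul (by fun_prop) h

/-- Tail bound for the operator norm of a Gaussian matrix, up to a measurable event. -/
theorem exists_event_norm_lt [IsProbabilityMeasure P] (hB : IsStdGaussianMatrix P B) {t : ℝ}
    (ht : 0 ≤ t) :
    ∃ G : Set Ω, MeasurableSet G ∧
      1 - Real.exp (2 * ((m : ℝ) + n) - t ^ 2 / 512) ≤ P.real G ∧
      ∀ ω ∈ G, ‖(Matrix.toEuclideanLin (B ω)).toContinuousLinearMap‖ < t := by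
  set E := EuclideanSpace ℝ (Fin m) × EuclideanSpace ℝ (Fin n)
  -- This minimizes `θ² / 2 - θ t / 16`, with value `-t² / 512`.
  set θ : ℝ := t / 16 with hθ
  set V : ENNReal := volume (ball (0 : E) 1) with hV
  set a : ℝ := Real.exp (θ * t / 16) * (1 / 4) ^ (m + n) with ha
  have ha0 : 0 < a := by positivity
  have : (volume : Measure E).IsAddHaarMeasure := Measure.prod.instIsAddHaarMeasure _ _
  have hV0 : V ≠ 0 := (measure_ball_pos _ _ one_pos).ne'
  have hVtop : V ≠ ⊤ := measure_ball_lt_top.ne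
  set F : Ω → ENNReal := fun ω => ∫⁻ q in ball (0 : E) 1,
    ENNReal.ofReal (Real.exp (θ * inner ℝ q.1 (Matrix.toEuclideanLin (B ω) q.2))) with hF
  have hFm : Measurable F := (hB.measurable_exp_inner θ).lintegral_prod_right'
  have hFint : ∫⁻ ω, F ω ∂P ≤ ENNReal.ofReal (Real.exp (θ ^ 2 / 2)) * V := by
    rw [hF, lintegral_lintegral_swap (hB.measurable_exp_inner θ).aemeasurable,
      ← setLIntegral_const]
    refine setLIntegral_mono' measurableSet_ball fun q hq => ?_
    rw [hB.lintegral_exp_inner]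
    rw [mem_ball_zero_iff, Prod.norm_def, max_lt_iff] at hq
    have h1 : ‖q.1‖ ^ 2 ≤ 1 := pow_le_one₀ (norm_nonneg _) hq.1.le
    have h2 : ‖q.2‖ ^ 2 ≤ 1 := pow_le_one₀ (norm_nonneg _) hq.2.le
    gcongr
    exact mul_le_of_le_one_right (sq_nonneg _) (mul_le_one₀ h1 (sq_nonneg _) h2)
  have hGm : MeasurableSet {ω | ENNReal.ofReal a * V ≤ F ω} :=
    measurableSet_le measurable_const hFm
  -- The event is cut out by `F`, which is measurable by Tonelli, so measurability of the norm is
  -- not needed. Markov's inequality bounds the complement.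
  refine ⟨{ω | ENNReal.ofReal a * V ≤ F ω}ᶜ, hGm.compl, ?_, fun ω hω => ?_⟩
  · rw [probReal_compl_eq_one_sub hGm]
    refine sub_le_sub_left ?_ 1
    have h := (mul_meas_ge_le_lintegral hFm (ENNReal.ofReal a * V)).trans hFint
    rw [mul_right_comm] at h
    have h' := ENNReal.toReal_mono (by finiteness) ((ENNReal.mul_le_mul_iff_left hV0 hVtop).1 h)
    rw [ENNReal.toReal_mul, ENNReal.toReal_ofReal ha0.le,
      ENNReal.toReal_ofReal (Real.exp_nonneg _)] at h'
    -- The volume ratio `4 ^ (m + n)` is absorbed because `4 ≤ e²`.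
    have h4 : (1 : ℝ) ≤ Real.exp (2 * ((m : ℝ) + n)) * (1 / 4) ^ (m + n) := by
      have : Real.exp (2 * ((m : ℝ) + n)) = Real.exp 2 ^ (m + n) := by
        rw [← Real.exp_nat_mul]
        push_cast
        ring_nf
      rw [this, ← mul_pow]
      refine one_le_pow₀ ?_
      have h5 : Real.exp 2 = Real.exp 1 * Real.exp 1 := by
        rw [← Real.exp_add]
        norm_num
      nlinarith [Real.exp_one_gt_d9]
    refine le_of_mul_le_mul_left (h'.trans ?_) ha0
    have h6 : a * Real.exp (2 * ((m : ℝ) + n) - t ^ 2 / 512) =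
        Real.exp (θ ^ 2 / 2) * (Real.exp (2 * ((m : ℝ) + n)) * (1 / 4) ^ (m + n)) := by
      have : Real.exp (θ * t / 16) * Real.exp (2 * ((m : ℝ) + n) - t ^ 2 / 512) =
          Real.exp (θ ^ 2 / 2) * Real.exp (2 * ((m : ℝ) + n)) := by
        rw [← Real.exp_add, ← Real.exp_add, hθ]
        ring_nf
      rw [ha, mul_right_comm, this]
      ring
    rw [h6]
    exact le_mul_of_one_le_right (Real.exp_nonneg _) h4
  · by_contra! hn
    refine hω (le_trans ?_ (exp_norm_mul_volume_le
      (Matrix.toEuclideanLin (B ω)).toContinuousLinearMap (θ := θ) (by positivity)))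
    simp only [finrank_euclideanSpace_fin, ha, hV]
    gcongr

end IsStdGaussianMatrix

/-! ### Slices, eigenvalues and marginals. -/

theorem inner_toEuclideanLin_cov {m₁ m₂ m₃ : ℕ} (T : Tensor m₁ m₂ m₃) (i : Fin m₁)
    (x : EuclideanSpace ℝ (Fin m₃)) :
    inner ℝ x (Matrix.toEuclideanLin (cov T i) x) =
      ‖Matrix.toEuclideanLin (slice T i) x‖ ^ 2 := by
  have h : Matrix.toEuclideanLin (cov T i) x =
      Matrix.toEuclideanLin (slice T i).conjTranspose (Matrix.toEuclideanLin (slice T i) x) := by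
    simp [cov, Matrix.toLpLin_apply, Matrix.conjTranspose_eq_transpose_of_trivial,
      Matrix.mulVec_mulVec]
  rw [h, Matrix.toEuclideanLin_conjTranspose_eq_adjoint, LinearMap.adjoint_inner_right,
    real_inner_self_eq_norm_sq]

theorem IsTopEigenvectorFamily.topEigenvalue_eq {m₁ m₂ m₃ : ℕ} {T : Tensor m₁ m₂ m₃}
    {x : Fin m₁ → EuclideanSpace ℝ (Fin m₃)} (hx : IsTopEigenvectorFamily T x) (i : Fin m₁) :
    topEigenvalue T i = ‖Matrix.toEuclideanLin (slice T i) (x i)‖ ^ 2 := by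
  rw [← inner_toEuclideanLin_cov, (hx i).2, real_inner_smul_right, real_inner_self_eq_norm_sq,
    (hx i).1]
  ring

theorem IsTopEigenvectorFamily.topEigenvalue_le {m₁ m₂ m₃ : ℕ} {T : Tensor m₁ m₂ m₃}
    {x : Fin m₁ → EuclideanSpace ℝ (Fin m₃)} (hx : IsTopEigenvectorFamily T x) (i : Fin m₁) :
    topEigenvalue T i ≤ ‖(Matrix.toEuclideanLin (slice T i)).toContinuousLinearMap‖ ^ 2 := by
  rw [hx.topEigenvalue_eq]
  gcongr
  exact (Matrix.toEuclideanLin (slice T i)).toContinuousLinearMap.unit_le_opNorm _ (hx i).1.le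

/-- Only the norms of the eigenvectors enter, through `c_ij ≤ λ̃_i λ̃_j ≤ λ̃_i`; hence the bound is
uniform in their choice. -/
theorem marginal_le {m₁ m₂ m₃ : ℕ} {T : Tensor m₁ m₂ m₃}
    {x : Fin m₁ → EuclideanSpace ℝ (Fin m₃)} (hx : IsTopEigenvectorFamily T x) (i : Fin m₁) :
    marginal T x i ≤ m₁ * (topEigenvalue T i / maxTopEigenvalue T) := by
  have h0 (j : Fin m₁) : 0 ≤ topEigenvalue T j := by
    rw [hx.topEigenvalue_eq]
    positivity
  have hmax (j : Fin m₁) : topEigenvalue T j ≤ maxTopEigenvalue T :=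
    le_ciSup (Set.finite_range fun j => topEigenvalue T j).bddAbove j
  have hn0 (j : Fin m₁) : 0 ≤ normTopEigenvalue T j := div_nonneg (h0 j) ((h0 j).trans (hmax j))
  have hn1 (j : Fin m₁) : normTopEigenvalue T j ≤ 1 :=
    div_le_one_of_le₀ (hmax j) ((h0 j).trans (hmax j))
  have hs (j : Fin m₁) : similarity T x i j ≤ normTopEigenvalue T i := by
    refine (abs_real_inner_le_norm _ _).trans ?_
    rw [norm_smul, norm_smul, (hx i).1, (hx j).1, mul_one, mul_one, Real.norm_of_nonneg (hn0 i),
      Real.norm_of_nonneg (hn0 j)]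
    exact mul_le_of_le_one_right (hn0 i) (hn1 j)
  calc marginal T x i ≤ ∑ _j : Fin m₁, normTopEigenvalue T i :=
        Finset.sum_le_sum fun j _ => hs j
    _ = _ := by simp [normTopEigenvalue]

/-- Lets `μ` absorb the dimension term of the tail bound. The factor `2` makes up for the `-1` under
the root, as `m₂ + m₃ ≥ 2`. -/
theorem add_le_two_mul_centering {m₂ m₃ : ℕ} (h₂ : 1 ≤ m₂) (h₃ : 1 ≤ m₃) :
    (m₂ : ℝ) + m₃ ≤ 2 * centering m₂ m₃ := by
  have h₂' : (1 : ℝ) ≤ m₂ := by exact_mod_cast h₂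
  have h₃' : (1 : ℝ) ≤ m₃ := by exact_mod_cast h₃
  have key (a b : ℝ) (ha : 1 ≤ a) (hb : 1 ≤ b) : a + b ≤ 2 * (√(a - 1) + √b) ^ 2 := by
    have h1 := Real.sq_sqrt (show 0 ≤ a - 1 by linarith)
    have h2 := Real.sq_sqrt (show 0 ≤ b by linarith)
    have h3 := mul_nonneg (Real.sqrt_nonneg (a - 1)) (Real.sqrt_nonneg b)
    nlinarith
  unfold centering
  split_ifs
  · exact key _ _ h₂' h₃'
  · rw [add_comm]
    exact key _ _ h₃' h₂'

theorem IsNoise.isStdGaussianMatrix_slice {Ω : Type*} [MeasurableSpace Ω] {P : Measure Ω}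
    {m₁ m₂ m₃ : ℕ} {J₁ : Finset (Fin m₁)} {Z : Ω → Tensor m₁ m₂ m₃} (hZ : IsNoise P J₁ Z)
    {i : Fin m₁} (hi : i ∉ J₁) : IsStdGaussianMatrix P fun ω => slice (Z ω) i where
  measurable := hZ.measurable i
  law := hZ.law i hi
  indep := by
    have hinj : Function.Injective fun p : Fin m₂ × Fin m₃ =>
        ((⟨i, hi⟩, p) : {i : Fin m₁ // i ∉ J₁} × Fin m₂ × Fin m₃) :=
      fun _ _ h => (Prod.mk.inj h).2
    exact hZ.indep.precomp hinj

theorem IsSignal.slice_add {m₁ m₂ m₃ : ℕ} {J₁ : Finset (Fin m₁)} {J₂ : Finset (Fin m₂)}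
    {J₃ : Finset (Fin m₃)} {γ : ℝ} {w : EuclideanSpace ℝ (Fin m₁)}
    {u : EuclideanSpace ℝ (Fin m₂)} {v : EuclideanSpace ℝ (Fin m₃)}
    (h : IsSignal J₁ J₂ J₃ γ w u v) {i : Fin m₁} (hi : i ∉ J₁) (Z : Tensor m₁ m₂ m₃) :
    slice (rankOne γ w u v + Z) i = slice Z i := by
  ext j k
  simp [slice, h.support i j k fun h' => hi h'.1]

end MultiSlice

/-! ### Choice of constants and conclusion. -/

theorem theorem2 (c κ : ℝ) (hc : 0 < c) (hκ : 0 < κ) :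
    ∃ c₁ : ℝ, 0 < c₁ ∧
      ∀ (m₁ m₂ m₃ : ℕ), 1 ≤ m₂ → 1 ≤ m₃ →
      ∀ (J₁ : Finset (Fin m₁)) (J₂ : Finset (Fin m₂)) (J₃ : Finset (Fin m₃)),
      √(Real.log ((m₁ : ℝ) - J₁.card)) ≤ κ * MultiSlice.centering m₂ m₃ →
      ∀ (γ : ℝ) (w : EuclideanSpace ℝ (Fin m₁)) (u : EuclideanSpace ℝ (Fin m₂))
        (v : EuclideanSpace ℝ (Fin m₃)), MultiSlice.IsSignal J₁ J₂ J₃ γ w u v →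
      ∀ (Ω : Type*) [MeasurableSpace Ω] (P : Measure Ω) [IsProbabilityMeasure P]
        (Z : Ω → MultiSlice.Tensor m₁ m₂ m₃), MultiSlice.IsNoise P J₁ Z →
      ∀ i : Fin m₁, i ∉ J₁ →
        ∃ G : Set Ω, MeasurableSet G ∧
          1 - Real.exp 1 * ((m₁ : ℝ) - J₁.card) ^ (-c₁) ≤ P.real G ∧
          ∀ ω ∈ G,
            c * (MultiSlice.centering m₂ m₃ * m₁) ≤
              MultiSlice.maxTopEigenvalue (MultiSlice.rankOne γ w u v + Z ω) →
            ∀ x : Fin m₁ → EuclideanSpace ℝ (Fin m₃),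
              MultiSlice.IsTopEigenvectorFamily (MultiSlice.rankOne γ w u v + Z ω) x →
              MultiSlice.marginal (MultiSlice.rankOne γ w u v + Z ω) x i ≤
                (J₁.card : ℝ) / m₁ + √(Real.log ((m₁ : ℝ) - J₁.card)) := by
  -- The first entry serves the case `s ≤ 4096 / c`, the second the case `s ≥ 4096 / c`.
  refine ⟨min ((c / 4096) ^ 2) (c / (1024 * κ)), by positivity, ?_⟩
  intro m₁ m₂ m₃ h₂ h₃ J₁ J₂ J₃ hlog γ w u v hX Ω _ P _ Z hZ i hi
  set c₁ := min ((c / 4096) ^ 2) (c / (1024 * κ)) with hc₁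
  set μ := MultiSlice.centering m₂ m₃
  have hdim : (m₂ : ℝ) + m₃ ≤ 2 * μ := MultiSlice.add_le_two_mul_centering h₂ h₃
  have hμ : 0 < μ := by
    have : (1 : ℝ) ≤ m₂ := by exact_mod_cast h₂
    have : (1 : ℝ) ≤ m₃ := by exact_mod_cast h₃
    linarith
  have hm₁ : (0 : ℝ) < m₁ := by exact_mod_cast i.pos
  have hN : (1 : ℝ) ≤ (m₁ : ℝ) - J₁.card := by
    have : J₁.card < m₁ := by
      simpa using Finset.card_lt_univ_of_notMem hi
    have : (J₁.card : ℝ) + 1 ≤ m₁ := by exact_mod_cast this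
    linarith
  set L := Real.log ((m₁ : ℝ) - J₁.card) with hL
  have hL0 : 0 ≤ L := Real.log_nonneg hN
  have hs := Real.sq_sqrt hL0
  set s := √L
  have hs0 : 0 ≤ s := Real.sqrt_nonneg L
  have hpow : Real.exp 1 * ((m₁ : ℝ) - J₁.card) ^ (-c₁) = Real.exp (1 - c₁ * L) := by
    rw [Real.rpow_def_of_pos (by linarith), ← Real.exp_add, ← hL]
    ring_nf
  rw [hpow]
  rcases le_total s (4096 / c) with hsmall | hlarge
  · refine ⟨∅, MeasurableSet.empty, ?_, by simp⟩
    have h1 : c₁ * L ≤ 1 := by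
      have h2 : c / 4096 * s ≤ 1 := by
        rw [le_div_iff₀ hc] at hsmall
        linarith
      calc c₁ * L ≤ (c / 4096) ^ 2 * L := by gcongr; exact min_le_left _ _
        _ = (c / 4096 * s) ^ 2 := by rw [← hs]; ring
        _ ≤ 1 := pow_le_one₀ (by positivity) h2
    have := Real.add_one_le_exp (1 - c₁ * L)
    rw [measureReal_empty]
    linarith
  · obtain ⟨G, hGm, hGP, hG⟩ := (hZ.isStdGaussianMatrix_slice hi).exists_event_norm_lt
      (Real.sqrt_nonneg (c * μ * s))
    have ht : √(c * μ * s) ^ 2 = c * μ * s := Real.sq_sqrt (by positivity)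
    refine ⟨G, hGm, le_trans (sub_le_sub_left (Real.exp_le_exp.2 ?_) 1) hGP, ?_⟩
    · rw [ht]
      -- The dimension term is at most `4 μ ≤ c μ s / 1024`, half of `t² / 512`; the other half
      -- dominates `c₁ L` because `s ≤ κ μ`.
      have h1 : 4096 * μ ≤ c * μ * s := by
        rw [div_le_iff₀ hc] at hlarge
        nlinarith
      have h2 : c₁ * L ≤ c * μ * s / 1024 := by
        calc c₁ * L ≤ c / (1024 * κ) * L := by gcongr; exact min_le_right _ _
          _ = c / (1024 * κ) * (s * s) := by rw [← hs]; ring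
          _ ≤ c / (1024 * κ) * (κ * μ * s) := by gcongr
          _ = c * μ * s / 1024 := by field_simp
      linarith
    · intro ω hω hmax x hx
      have hlam := hx.topEigenvalue_le i
      rw [hX.slice_add hi] at hlam
      have hlam' : MultiSlice.topEigenvalue (MultiSlice.rankOne γ w u v + Z ω) i ≤ c * μ * s := by
        rw [← ht]
        exact hlam.trans (pow_le_pow_left₀ (norm_nonneg _) (hG ω hω).le 2)
      have hcm : 0 < c * (μ * m₁) := by positivity
      calc _ ≤ m₁ * (MultiSlice.topEigenvalue (MultiSlice.rankOne γ w u v + Z ω) i /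
              MultiSlice.maxTopEigenvalue (MultiSlice.rankOne γ w u v + Z ω)) :=
            MultiSlice.marginal_le hx i
        _ ≤ m₁ * (c * μ * s / (c * (μ * m₁))) := by gcongr
        _ = s := by field_simp
        _ ≤ _ := le_add_of_nonneg_left (by positivity)
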